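/- Let $n,m,\ell$ be nonnegative integers, $\gamma>0$, $\lambda\ge 0$, let $C\in\mathbb{R}^{n\times m}$, $A\in\mathbb{R}^{\ell\times n}$, $B\in\mathbb{R}^{\ell\times m}$, and let $\mathcal{K}\subseteq\mathbb{R}^{n\times m}$ be a closed convex cone (containing $0$). For $X\in\mathbb{R}^{n\times m}$ put $g(X)=\langle C,X\rangle$ if $AX=B$ and $X\in\mathcal{K}$, and $g(X)=+\infty$ otherwise. Let $S^p$ be the set of symmetric real $p\times p$ matrices, let $\mathcal{Y}_p=\{P\in S^p: P^2=P\}$ be the set of $p \times p$ orthogonal projection matrices and $\mathrm{Conv}(\mathcal{Y}_p)$ its convex hull, and let $\sigma_1(X)\ge\sigma_2(X)\ge\dots$ be the singular values of $X$, with $\sigma_i(X)=0$ for $i>\min(n,m)$. Define the reverse Huber penalty of $t\ge 0$ by $$H(t)=\begin{cases}\sqrt{\tfrac{2\lambda}{\gamma}}\,t, & t\le\sqrt{2\gamma\lambda},\\[2pt] \lambda+\tfrac{t^2}{2\gamma}, & t>\sqrt{2\gamma\lambda}.\end{cases}$$ Then the problem $$\min_{Y\in\mathrm{Conv}(\mathcal{Y}_n)}\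 \min_{X\in\mathbb{R}^{n\times m},\,\theta\in S^m}\ g(X)+\frac{1}{2\gamma}\mathrm{tr}(\theta)+\lambda\,\mathrm{tr}(Y)\quad\text{s.t.}\quad\begin{pmatrix}\theta & X^\top\\ X & Y\end{pmatrix}\succeq 0 \tag{1}$$ is equivalent to the problem $$\min_{X\in\mathbb{R}^{n\times m}}\ g(X)+\sum_{i=1}^n H(\sigma_i(X)). \tag{2}$$ Equivalence means: (i) the two problems have the same optimal value in $[-\infty,+\infty]$; (ii) $X$ is an optimal solution of (2) (of finite cost) if and only if there are $Y,\theta$ such that $(X,Y,\theta)$ is an optimal solution of (1) (of finite cost); (iii) for every fixed $X$, the minimum over $(Y,\theta)$ of the objective of (1) subject to its constraints is attained and equals the objective of (2) at $X$; (iv) if $g$ is finite somewhere, the minimum in (2) (and hence, by (ii), that in (1)) is attained. The same holds, with the same problem (2), if (1) is replaced by its version for the row space, where $Y\in\mathrm{Conv}(\mathcal{Y}_m)$, $\theta\in S^n$ and the constraint is $\begin{pmatrix}\theta & X\\ X^\top & Y\end{pmatrix}\succeq 0$. -/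

import Mathlib

/-! ### Minimization problems with extended-real objective -/

/-- A minimization problem `min objective v  s.t.  v ∈ feasible`; the objective may be `+∞`. -/
structure MinProblem (V : Type*) where
  feasible : Set V
  objective : V → EReal

namespace MinProblem

/-- The optimal value (`+∞` if the problem is infeasible). -/
noncomputable def value {V : Type*} (P : MinProblem V) : EReal :=
  ⨅ v ∈ P.feasible, P.objective v

/-- `v` is an optimal solution: it is feasible, its cost is not `+∞`, and no feasible point has
a smaller cost. -/
def IsOptimal {V : Type*} (P : MinProblem V) (v : V) : Prop :=
  v ∈ P.feasible ∧ P.objective v ≠ ⊤ ∧ ∀ w ∈ P.feasible, P.objective v ≤ P.objective w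

/-- Equivalence of a problem `P` in the variables `(x, d)` with a problem `Q` in the variable `x`
alone. -/
structure IsEquivalent {E D : Type*} (P : MinProblem (E × D)) (Q : MinProblem E) : Prop where
  /-- Both problems have the same optimal value. -/
  value_eq : P.value = Q.value
  /-- The optimal solutions of `Q` are the `x`-parts of the optimal solutions of `P`. -/
  isOptimal_iff : ∀ x, Q.IsOptimal x ↔ ∃ d, P.IsOptimal (x, d)
  /-- For each fixed feasible `x`, minimizing `P` over `d` gives the cost of `x` in `Q`, and this
  minimum is attained. -/
  isLeast : ∀ x ∈ Q.feasible,
    IsLeast {c : EReal | ∃ d, (x, d) ∈ P.feasible ∧ P.objective (x, d) = c} (Q.objective x)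
  /-- The minimum is attained as soon as some point has finite cost. -/
  exists_isOptimal : (∃ x ∈ Q.feasible, Q.objective x ≠ ⊤) → ∃ x, Q.IsOptimal x

end MinProblem

/-! ### The matrix problems -/

/-- The set of `n × n` orthogonal projection matrices. -/
def orthProjMatrices (n : ℕ) : Set (Matrix (Fin n) (Fin n) ℝ) :=
  {P | P.IsSymm ∧ P * P = P}

/-- `singularValue X i` is the singular value number `i` of `X`, in decreasing order and counted
from `0`; it is `0` for `i ≥ min n m`. -/
noncomputable def singularValue {n m : ℕ} (X : Matrix (Fin n) (Fin m) ℝ) (i : ℕ) : ℝ :=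
  (Matrix.toEuclideanLin X).singularValues i

open Classical in
/-- The second-stage cost `g(X)`: it is `⟨C, X⟩` if `A X = B` and `X ∈ K`, and `+∞` otherwise. -/
noncomputable def secondStageCost {n m l : ℕ} (C : Matrix (Fin n) (Fin m) ℝ)
    (A : Matrix (Fin l) (Fin n) ℝ) (B : Matrix (Fin l) (Fin m) ℝ)
    (K : ProperCone ℝ (Matrix (Fin n) (Fin m) ℝ)) (X : Matrix (Fin n) (Fin m) ℝ) : EReal :=
  if A * X = B ∧ X ∈ K then ((∑ i, ∑ j, C i j * X i j : ℝ) : EReal) else ⊤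

/-- The reverse Huber penalty with parameters `lam` and `γ`. -/
noncomputable def reverseHuber (lam γ t : ℝ) : ℝ :=
  if t ≤ √(2 * γ * lam) then √(2 * lam / γ) * t else lam + t ^ 2 / (2 * γ)

/-- The perspective relaxation with column-space variable `Y`: minimize
`g(X) + tr θ / (2γ) + lam * tr Y` over `X ∈ ℝ^{n × m}`, `Y ∈ Conv(Y_n)` and symmetric
`θ ∈ ℝ^{m × m}` with `[θ, Xᵀ; X, Y] ⪰ 0`. -/
noncomputable def perspectiveRelaxation {n m : ℕ} (g : Matrix (Fin n) (Fin m) ℝ → EReal)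
    (lam γ : ℝ) :
    MinProblem (Matrix (Fin n) (Fin m) ℝ ×
      (Matrix (Fin n) (Fin n) ℝ × Matrix (Fin m) (Fin m) ℝ)) where
  feasible := {v | v.2.1 ∈ convexHull ℝ (orthProjMatrices n) ∧ v.2.2.IsSymm ∧
    (Matrix.fromBlocks v.2.2 v.1.transpose v.1 v.2.1).PosSemidef}
  objective v := g v.1 + ((1 / (2 * γ) * v.2.2.trace + lam * v.2.1.trace : ℝ) : EReal)

/-- The perspective relaxation with row-space variable `Y`: minimize
`g(X) + tr θ / (2γ) + lam * tr Y` over `X ∈ ℝ^{n × m}`, `Y ∈ Conv(Y_m)` and symmetric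
`θ ∈ ℝ^{n × n}` with `[θ, X; Xᵀ, Y] ⪰ 0`. -/
noncomputable def perspectiveRelaxationRow {n m : ℕ} (g : Matrix (Fin n) (Fin m) ℝ → EReal)
    (lam γ : ℝ) :
    MinProblem (Matrix (Fin n) (Fin m) ℝ ×
      (Matrix (Fin m) (Fin m) ℝ × Matrix (Fin n) (Fin n) ℝ)) where
  feasible := {v | v.2.1 ∈ convexHull ℝ (orthProjMatrices m) ∧ v.2.2.IsSymm ∧
    (Matrix.fromBlocks v.2.2 v.1 v.1.transpose v.2.1).PosSemidef}
  objective v := g v.1 + ((1 / (2 * γ) * v.2.2.trace + lam * v.2.1.trace : ℝ) : EReal)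

/-- The penalized problem: minimize `g(X)` plus the sum of the reverse Huber penalties of the
singular values `σ_1(X), …, σ_n(X)`. -/
noncomputable def reverseHuberProblem {n m : ℕ} (g : Matrix (Fin n) (Fin m) ℝ → EReal)
    (lam γ : ℝ) : MinProblem (Matrix (Fin n) (Fin m) ℝ) where
  feasible := Set.univ
  objective X := g X + ((∑ i : Fin n, reverseHuber lam γ (singularValue X i) : ℝ) : EReal)

/-! Fix `X` with compact SVD `U diag(s) Vᵀ`. The convex hull of the projections is `{Y | 0 ⪯ Y ⪯ 1}`
(`convexHull_orthProjMatrices`), and the inner minimum decouples into scalar problems: `H(s)` is the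
minimum of `s²/(2γy) + λy` over `0 < y ≤ 1`. For the lower bound (`sum_reverseHuber_le`),
compression by `V` and `U` does not increase traces and leaves the `2 × 2` conditions `sᵢ² ≤ tᵢ yᵢ`.
Equality is reached by `Y = U diag(y) Uᵀ`, `θ = V diag(s²/y) Vᵀ` with the scalar minimizers `y`.
Exchanging `U` and `V` gives the row version. Attainment is proved for the joint problem in `(X, Y,
θ)`, whose objective is linear: `tr θ` controls every entry of `X` quadratically, hence dominates
`⟨C, X⟩`, and sublevel sets are compact. -/

/-! ### Positive semidefinite matrices and the hull of the projections. -/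

open Matrix in
theorem Matrix.PosSemidef.sq_apply_le {ι : Type*} {M : Matrix ι ι ℝ} (hM : M.PosSemidef)
    (i j : ι) : M i j ^ 2 ≤ M i i * M j j := by
  have h := (hM.submatrix ![i, j]).det_nonneg
  have hs : M j i = M i j := by simpa using hM.1.apply i j
  rw [det_fin_two] at h
  simp only [submatrix_apply, cons_val_zero, cons_val_one, hs] at h
  nlinarith

-- The cube is the convex hull of its vertices, and the linear map `y ↦ U diag(y) Uᵀ` sends 0/1
-- vectors to projections.
open Matrix in
theorem mul_diagonal_mul_transpose_mem_convexHull {n : ℕ} {ι : Type*} [Fintype ι] [DecidableEq ι]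
    {U : Matrix (Fin n) ι ℝ} (hU : Uᵀ * U = 1) {y : ι → ℝ} (hy : ∀ i, y i ∈ Set.Icc (0 : ℝ) 1) :
    U * diagonal y * Uᵀ ∈ convexHull ℝ (orthProjMatrices n) := by
  have hmem : y ∈ convexHull ℝ (Set.univ.pi fun _ : ι => ({0, 1} : Set ℝ)) := by
    refine mem_convexHull_pi fun i _ => ?_
    rw [convexHull_pair, segment_eq_Icc zero_le_one]
    exact hy i
  have hlin : IsLinearMap ℝ fun y : ι → ℝ => U * diagonal y * Uᵀ := by
    constructor
    · intro a b
      rw [← Matrix.add_mul, ← Matrix.mul_add, diagonal_add]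
      rfl
    · intro c a
      rw [diagonal_smul, Matrix.mul_smul, Matrix.smul_mul]
  have himg := Set.mem_image_of_mem (fun y : ι → ℝ => U * diagonal y * Uᵀ) hmem
  rw [hlin.image_convexHull] at himg
  refine convexHull_mono ?_ himg
  rintro _ ⟨z, hz, rfl⟩
  refine ⟨by simp [Matrix.IsSymm, Matrix.mul_assoc], ?_⟩
  have hzz : diagonal z * diagonal z = diagonal z := by
    rw [diagonal_mul_diagonal]
    congr 1
    ext i
    rcases hz i trivial with h | h <;> simp_all
  calc U * diagonal z * Uᵀ * (U * diagonal z * Uᵀ)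
      = U * diagonal z * (Uᵀ * U) * diagonal z * Uᵀ := by simp only [Matrix.mul_assoc]
    _ = U * (diagonal z * diagonal z) * Uᵀ := by rw [hU, Matrix.mul_one, Matrix.mul_assoc U]
    _ = U * diagonal z * Uᵀ := by rw [hzz]

open Matrix in
theorem posSemidef_of_isSymm_of_mul_self {ι : Type*} [Fintype ι] {P : Matrix ι ι ℝ}
    (hs : P.IsSymm) (hP : P * P = P) : P.PosSemidef := by
  have h := posSemidef_conjTranspose_mul_self P
  rwa [conjTranspose_eq_transpose_of_trivial, hs.eq, hP] at h

open Matrix in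
theorem one_sub_mul_self {ι : Type*} [Fintype ι] [DecidableEq ι] {P : Matrix ι ι ℝ}
    (hP : P * P = P) : (1 - P) * (1 - P) = 1 - P := by
  rw [Matrix.sub_mul, Matrix.mul_sub, Matrix.mul_sub, hP]
  simp

open Matrix in
theorem convexHull_orthProjMatrices (n : ℕ) :
    convexHull ℝ (orthProjMatrices n) = {Y | Y.PosSemidef ∧ (1 - Y).PosSemidef} := by
  apply Set.Subset.antisymm
  · refine convexHull_min ?_ ?_
    · rintro P ⟨hs, hP⟩
      exact ⟨posSemidef_of_isSymm_of_mul_self hs hP, posSemidef_of_isSymm_of_mul_self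
        (isSymm_one.sub hs) (one_sub_mul_self hP)⟩
    · rintro P ⟨hP, hP'⟩ Q ⟨hQ, hQ'⟩ a b ha hb hab
      refine ⟨(hP.smul ha).add (hQ.smul hb), ?_⟩
      have h : (1 : Matrix (Fin n) (Fin n) ℝ) - (a • P + b • Q) = a • (1 - P) + b • (1 - Q) := by
        rw [smul_sub, smul_sub, sub_add_sub_comm, ← add_smul, hab, one_smul]
      rw [h]
      exact (hP'.smul ha).add (hQ'.smul hb)
  · rintro Y ⟨hY, hY'⟩
    have hU : (hY.1.eigenvectorUnitary : Matrix (Fin n) (Fin n) ℝ)ᵀ * hY.1.eigenvectorUnitary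
        = 1 := by
      rw [← conjTranspose_eq_transpose_of_trivial]
      exact Unitary.coe_star_mul_self hY.1.eigenvectorUnitary
    have hspec : Y = (hY.1.eigenvectorUnitary : Matrix (Fin n) (Fin n) ℝ)
        * diagonal hY.1.eigenvalues * (hY.1.eigenvectorUnitary : Matrix (Fin n) (Fin n) ℝ)ᵀ := by
      conv_lhs => rw [hY.1.spectral_theorem]
      rw [Unitary.conjStarAlgAut_apply]
      rfl
    generalize (hY.1.eigenvectorUnitary : Matrix (Fin n) (Fin n) ℝ) = U at hU hspec
    have hle : ∀ i, hY.1.eigenvalues i ≤ 1 := by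
      intro i
      have h := (hY'.conjTranspose_mul_mul_same U).diag_nonneg (i := i)
      have h2 : Uᴴ * (1 - Y) * U = 1 - diagonal hY.1.eigenvalues := by
        rw [conjTranspose_eq_transpose_of_trivial, Matrix.mul_sub, Matrix.sub_mul, Matrix.mul_one,
          hU]
        congr 1
        conv_lhs => rw [hspec]
        calc Uᵀ * (U * diagonal hY.1.eigenvalues * Uᵀ) * U
            = (Uᵀ * U) * diagonal hY.1.eigenvalues * (Uᵀ * U) := by
              simp only [Matrix.mul_assoc]
          _ = _ := by rw [hU, Matrix.one_mul, Matrix.mul_one]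
      rw [h2] at h
      simpa using h
    rw [hspec]
    exact mul_diagonal_mul_transpose_mem_convexHull hU fun i => ⟨hY.eigenvalues_nonneg i, hle i⟩

-- The difference of the two traces is `tr(PθP) ≥ 0` for the complementary projection `P = 1 - VVᵀ`.
open Matrix in
theorem trace_transpose_mul_mul_le {ι κ : Type*} [Fintype ι] [Fintype κ] [DecidableEq ι]
    [DecidableEq κ]
    {V : Matrix ι κ ℝ} (hV : Vᵀ * V = 1) {θ : Matrix ι ι ℝ} (hθ : θ.PosSemidef) :
    (Vᵀ * θ * V).trace ≤ θ.trace := by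
  set P := 1 - V * Vᵀ with hPdef
  have hs : P.IsSymm := isSymm_one.sub (by simp [Matrix.IsSymm])
  have hP : P * P = P := one_sub_mul_self (by
    calc V * Vᵀ * (V * Vᵀ) = V * (Vᵀ * V) * Vᵀ := by simp only [Matrix.mul_assoc]
      _ = V * Vᵀ := by rw [hV, Matrix.mul_one])
  have h := (hθ.conjTranspose_mul_mul_same P).trace_nonneg
  rw [conjTranspose_eq_transpose_of_trivial, hs.eq, Matrix.mul_assoc, trace_mul_comm,
    Matrix.mul_assoc, hP, hPdef, Matrix.mul_sub, Matrix.mul_one, trace_sub, ← Matrix.mul_assoc,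
    trace_mul_comm (θ * V), ← Matrix.mul_assoc] at h
  linarith

/-! ### Singular value decomposition. -/

open Matrix in
/-- A compact singular value decomposition. -/
theorem exists_compact_svd {n m : ℕ} (X : Matrix (Fin n) (Fin m) ℝ) :
    ∃ (r : ℕ) (U : Matrix (Fin n) (Fin r) ℝ) (V : Matrix (Fin m) (Fin r) ℝ) (s : Fin r → ℝ),
      Uᵀ * U = 1 ∧ Vᵀ * V = 1 ∧ (∀ i, 0 < s i) ∧ X = U * diagonal s * Vᵀ ∧
      ∀ f : ℝ → ℝ, f 0 = 0 → ∑ i : Fin n, f (singularValue X i) = ∑ i, f (s i) := by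
  set T := toEuclideanLin X with hT
  have hfin : Module.finrank ℝ (EuclideanSpace ℝ (Fin m)) = m := by simp
  set r := Module.finrank ℝ T.range with hr
  have hrn : r ≤ n := by
    have := T.range.finrank_le
    simpa using this
  have hrm : r ≤ m := by
    have := T.finrank_range_le
    simpa using this
  set e := T.isSymmetric_adjoint_comp_self.eigenvectorBasis hfin with he
  -- The images under `T` of the eigenvectors of `T*T` are orthogonal with norms `σ`; the first `r`
  -- of them, normalized, form the columns of `U`.
  have hTT : ∀ k l, inner ℝ (T (e k)) (T (e l)) = if k = l then T.singularValues l ^ 2 else 0 := by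
    intro k l
    rw [← LinearMap.adjoint_inner_right, ← LinearMap.comp_apply, he,
      T.isSymmetric_adjoint_comp_self.apply_eigenvectorBasis hfin l, ← he,
      T.sq_singularValues_fin hfin l, inner_smul_right,
      orthonormal_iff_ite.mp e.orthonormal k l]
    simp
  have hpos : ∀ k : Fin r, 0 < T.singularValues k := fun k =>
    T.singularValues_pos_iff_lt_finrank_range.mpr k.2
  have hinner : ∀ (p : ℕ) (x y : EuclideanSpace ℝ (Fin p)), inner ℝ x y = ∑ j, x j * y j := by
    intro p x y
    simp [PiLp.inner_apply, mul_comm]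
  have hc : ∀ k l : Fin r, Fin.castLE hrm k = Fin.castLE hrm l ↔ k = l := fun k l =>
    (Fin.castLE_injective hrm).eq_iff
  refine ⟨r, of fun i k => T (e (Fin.castLE hrm k)) i / T.singularValues k,
    of fun j k => e (Fin.castLE hrm k) j, fun k => T.singularValues k, ?_, ?_, hpos, ?_, ?_⟩
  · ext k l
    have h := hTT (Fin.castLE hrm k) (Fin.castLE hrm l)
    rw [hinner] at h
    simp only [hc] at h
    simp only [mul_apply, transpose_apply, of_apply, div_mul_div_comm]
    rw [← Finset.sum_div, h, one_apply]
    split_ifs with hkl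
    · subst hkl
      have := (hpos k).ne'
      simp only [Fin.val_castLE]
      field_simp
    · simp
  · ext k l
    have h := orthonormal_iff_ite.mp e.orthonormal (Fin.castLE hrm k) (Fin.castLE hrm l)
    rw [hinner] at h
    simp only [hc] at h
    simpa only [mul_apply, transpose_apply, of_apply, one_apply] using h
  -- Both sides are compared on the eigenbasis; from index `r` on, both give `0`.
  · apply toEuclideanLin.injective
    refine e.toBasis.ext fun l => ?_
    rw [e.coe_toBasis, ← hT]
    ext i
    have hmul : ∀ (M : Matrix (Fin n) (Fin r) ℝ) (L : Matrix (Fin r) (Fin m) ℝ)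
        (v : EuclideanSpace ℝ (Fin m)),
        toEuclideanLin (M * L) v = WithLp.toLp 2 (M *ᵥ (L *ᵥ v.ofLp)) := by
      intro M L v
      rw [mulVec_mulVec]
      rfl
    rw [hmul]
    have hV : ∀ k : Fin r, ((of fun j k => e (Fin.castLE hrm k) j : Matrix (Fin m) (Fin r) ℝ)ᵀ *ᵥ
        (e l).ofLp) k = if Fin.castLE hrm k = l then 1 else 0 := by
      intro k
      have h := orthonormal_iff_ite.mp e.orthonormal (Fin.castLE hrm k) l
      rw [hinner] at h
      simpa only [mulVec, dotProduct, transpose_apply, of_apply] using h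
    simp only [mulVec, dotProduct, mul_diagonal, of_apply] at hV ⊢
    simp only [hV]
    by_cases hl : (l : ℕ) < r
    · rw [Finset.sum_eq_single ⟨l, hl⟩]
      · have h0 := (hpos ⟨l, hl⟩).ne'
        have h1 : Fin.castLE hrm ⟨l, hl⟩ = l := rfl
        simp only [h1] at h0 ⊢
        simp only [if_true]
        field_simp
      · intro k _ hk
        have : Fin.castLE hrm k ≠ l := fun h => hk (by ext; simp [← h])
        simp [this]
      · simp
    · have h0 : T (e l) = 0 := by
        have h := hTT l l
        rw [if_pos rfl, T.singularValues_eq_zero_iff_le_finrank_range.mpr (not_lt.mp hl)] at h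
        simpa using h
      rw [h0]
      symm
      refine Finset.sum_eq_zero fun k _ => ?_
      have : Fin.castLE hrm k ≠ l := fun h => hl (by simp [← h])
      simp [this]
  · intro f hf
    have h0 : ∀ i : ℕ, r ≤ i → f (T.singularValues i) = 0 := fun i hi => by
      rw [T.singularValues_eq_zero_iff_le_finrank_range.mpr hi, hf]
    change ∑ i : Fin n, f (T.singularValues i) = ∑ i : Fin r, f (T.singularValues i)
    rw [Fin.sum_univ_eq_sum_range (fun i => f (T.singularValues i)),
      Fin.sum_univ_eq_sum_range (fun i => f (T.singularValues i))]
    symm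
    refine Finset.sum_subset (Finset.range_mono hrn) fun i _ hi => h0 i ?_
    simpa using hi

/-! ### The scalar problem behind the reverse Huber penalty. -/

theorem reverseHuber_zero (lam γ : ℝ) : reverseHuber lam γ 0 = 0 := by
  rw [reverseHuber, if_pos (Real.sqrt_nonneg _), mul_zero]

theorem sqrt_two_mul_div_eq {lam γ : ℝ} (hγ : 0 < γ) : √(2 * lam / γ) = √(2 * γ * lam) / γ := by
  rw [show 2 * lam / γ = 2 * γ * lam / γ ^ 2 by field_simp, Real.sqrt_div' _ (sq_nonneg γ),
    Real.sqrt_sq hγ.le]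

theorem reverseHuber_le {lam γ : ℝ} (hlam : 0 ≤ lam) (hγ : 0 < γ) {s t y : ℝ}
    (hy : 0 ≤ y) (hy1 : y ≤ 1) (ht : 0 ≤ t) (h : s ^ 2 ≤ t * y) :
    reverseHuber lam γ s ≤ 1 / (2 * γ) * t + lam * y := by
  rw [reverseHuber, sqrt_two_mul_div_eq hγ]
  have hT0 : 0 ≤ √(2 * γ * lam) := Real.sqrt_nonneg _
  have hT : √(2 * γ * lam) ^ 2 = 2 * γ * lam := Real.sq_sqrt (by positivity)
  generalize √(2 * γ * lam) = T at hT hT0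
  -- Writing `lam` through the threshold `T` removes the square roots.
  obtain rfl : lam = T ^ 2 / (2 * γ) := by field_simp; linarith
  split_ifs with hs
  -- AM-GM: `(t + T²y)² ≥ 4T²ty ≥ 4T²s²`.
  · have h2 : 2 * T * s ≤ t + T ^ 2 * y := by
      have : (2 * T * s) ^ 2 ≤ (t + T ^ 2 * y) ^ 2 := by
        nlinarith [sq_nonneg (t - T ^ 2 * y), mul_le_mul_of_nonneg_left h (sq_nonneg T)]
      exact le_of_sq_le_sq this (by positivity)
    calc T / γ * s = (2 * T * s) / (2 * γ) := by field_simp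
      _ ≤ (t + T ^ 2 * y) / (2 * γ) := by gcongr
      _ = _ := by field_simp
  · have h2 : T ^ 2 + s ^ 2 ≤ t + T ^ 2 * y := by
      have hTs : T ^ 2 ≤ s ^ 2 := by gcongr; exact (not_le.mp hs).le
      have hy0 : 0 < y := by
        rcases hy.lt_or_eq with h0 | h0
        · exact h0
        · subst h0
          nlinarith [not_le.mp hs]
      -- Since `ty ≥ s²`, the right side is at least `(1 - y)(s² - T²) + (1 - y)²T²`.
      have h3 : 0 ≤ y * (t + T ^ 2 * y - T ^ 2 - s ^ 2) := by
        nlinarith [mul_nonneg (sub_nonneg.mpr hy1) (sub_nonneg.mpr hTs),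
          mul_nonneg (mul_nonneg (sub_nonneg.mpr hy1) (sub_nonneg.mpr hy1)) (sq_nonneg T)]
      have := nonneg_of_mul_nonneg_right h3 hy0
      linarith
    calc T ^ 2 / (2 * γ) + s ^ 2 / (2 * γ) = (T ^ 2 + s ^ 2) / (2 * γ) := by field_simp
      _ ≤ (t + T ^ 2 * y) / (2 * γ) := by gcongr
      _ = _ := by field_simp

theorem exists_reverseHuber_eq {lam γ : ℝ} (hlam : 0 ≤ lam) (hγ : 0 < γ) {s : ℝ} (hs : 0 < s) :
    ∃ y, 0 < y ∧ y ≤ 1 ∧ 1 / (2 * γ) * (s ^ 2 / y) + lam * y = reverseHuber lam γ s := by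
  rw [reverseHuber, sqrt_two_mul_div_eq hγ]
  have hT0 : 0 ≤ √(2 * γ * lam) := Real.sqrt_nonneg _
  have hT : √(2 * γ * lam) ^ 2 = 2 * γ * lam := Real.sq_sqrt (by positivity)
  generalize √(2 * γ * lam) = T at hT hT0
  obtain rfl : lam = T ^ 2 / (2 * γ) := by field_simp; linarith
  split_ifs with h
  · have hTpos : 0 < T := hs.trans_le h
    -- The stationary point of `y ↦ s²/y + T²y`; above the threshold it exceeds `1`, and `y = 1` is
    -- taken instead.
    refine ⟨s / T, by positivity, (div_le_one hTpos).mpr h, ?_⟩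
    field_simp
    ring
  · refine ⟨1, one_pos, le_rfl, ?_⟩
    field_simp
    ring

/-! ### Minimization over `(Y, θ)` for fixed `X`. -/

open Matrix in
theorem sum_reverseHuber_le {ι p q : Type*} [Fintype ι] [Fintype p] [Fintype q] [DecidableEq ι]
    [DecidableEq p] [DecidableEq q] {lam γ : ℝ} (hlam : 0 ≤ lam) (hγ : 0 < γ)
    {U : Matrix p ι ℝ} {V : Matrix q ι ℝ} (hU : Uᵀ * U = 1) (hV : Vᵀ * V = 1)
    (s : ι → ℝ) {Y : Matrix p p ℝ} {θ : Matrix q q ℝ} (hY : Y.PosSemidef)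
    (hY' : (1 - Y).PosSemidef)
    (hM : (fromBlocks θ (U * diagonal s * Vᵀ)ᵀ (U * diagonal s * Vᵀ) Y).PosSemidef) :
    ∑ i, reverseHuber lam γ (s i) ≤ 1 / (2 * γ) * θ.trace + lam * Y.trace := by
  have hθ : θ.PosSemidef := hM.submatrix Sum.inl
  -- Compression by the block diagonal matrix of `V` and `U` turns `X` into `diag(s)`; only diagonal
  -- entries and `2 × 2` minors are used afterwards.
  have hN : (fromBlocks (Vᵀ * θ * V) (diagonal s) (diagonal s) (Uᵀ * Y * U)).PosSemidef := by
    have h := hM.conjTranspose_mul_mul_same (fromBlocks V 0 0 U)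
    have h1 : Vᵀ * (U * diagonal s * Vᵀ)ᵀ * U = diagonal s := by
      calc Vᵀ * (U * diagonal s * Vᵀ)ᵀ * U = (Vᵀ * V) * diagonal s * (Uᵀ * U) := by
            simp [Matrix.mul_assoc]
        _ = _ := by rw [hU, hV, Matrix.one_mul, Matrix.mul_one]
    have h2 : Uᵀ * (U * diagonal s * Vᵀ) * V = diagonal s := by
      calc Uᵀ * (U * diagonal s * Vᵀ) * V = (Uᵀ * U) * diagonal s * (Vᵀ * V) := by
            simp [Matrix.mul_assoc]
        _ = _ := by rw [hU, hV, Matrix.one_mul, Matrix.mul_one]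
    rw [fromBlocks_conjTranspose, fromBlocks_multiply, fromBlocks_multiply] at h
    simpa only [conjTranspose_eq_transpose_of_trivial, transpose_zero, Matrix.zero_mul,
      Matrix.mul_zero, add_zero, zero_add, h1, h2] using h
  have hy1 : ∀ i, (Uᵀ * Y * U) i i ≤ 1 := by
    intro i
    have h := (hY'.conjTranspose_mul_mul_same U).diag_nonneg (i := i)
    rw [conjTranspose_eq_transpose_of_trivial, Matrix.mul_sub, Matrix.sub_mul, Matrix.mul_one,
      hU] at h
    simpa using h
  have hterm : ∀ i, reverseHuber lam γ (s i) ≤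
      1 / (2 * γ) * (Vᵀ * θ * V) i i + lam * (Uᵀ * Y * U) i i := by
    intro i
    refine reverseHuber_le hlam hγ ?_ (hy1 i) ?_ ?_
    · simpa using hN.diag_nonneg (i := Sum.inr i)
    · simpa using hN.diag_nonneg (i := Sum.inl i)
    · simpa using hN.sq_apply_le (Sum.inl i) (Sum.inr i)
  calc ∑ i, reverseHuber lam γ (s i)
      ≤ ∑ i, (1 / (2 * γ) * (Vᵀ * θ * V) i i + lam * (Uᵀ * Y * U) i i) :=
        Finset.sum_le_sum fun i _ => hterm i
    _ = 1 / (2 * γ) * (Vᵀ * θ * V).trace + lam * (Uᵀ * Y * U).trace := by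
        rw [Finset.sum_add_distrib, ← Finset.mul_sum, ← Finset.mul_sum]
        rfl
    _ ≤ _ := by
        gcongr
        · exact trace_transpose_mul_mul_le hV hθ
        · exact trace_transpose_mul_mul_le hU hY

-- This is the Gram matrix `WWᵀ`, where `W` stacks `V diag(s/√y)` on `U diag(√y)`.
open Matrix in
theorem posSemidef_fromBlocks_of_factors {ι p q : Type*} [Fintype ι] [Fintype p] [Fintype q]
    [DecidableEq ι] (U : Matrix p ι ℝ) (V : Matrix q ι ℝ) (s : ι → ℝ) {y : ι → ℝ}
    (hy : ∀ i, 0 < y i) :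
    (fromBlocks (V * diagonal (fun i => s i ^ 2 / y i) * Vᵀ) (U * diagonal s * Vᵀ)ᵀ
      (U * diagonal s * Vᵀ) (U * diagonal y * Uᵀ)).PosSemidef := by
  have h := posSemidef_self_mul_conjTranspose
    (fromRows (V * diagonal fun i => s i / √(y i)) (U * diagonal fun i => √(y i)))
  rw [conjTranspose_eq_transpose_of_trivial, transpose_fromRows, fromRows_mul_fromCols] at h
  have hne : ∀ i, √(y i) ≠ 0 := fun i => (Real.sqrt_pos.mpr (hy i)).ne'
  have hsq : ∀ i, √(y i) * √(y i) = y i := fun i => Real.mul_self_sqrt (hy i).le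
  convert! h using 2
  · rw [transpose_mul, diagonal_transpose, Matrix.mul_assoc, Matrix.mul_assoc,
      ← Matrix.mul_assoc (diagonal _) (diagonal _), diagonal_mul_diagonal]
    congr 3
    ext i
    rw [div_mul_div_comm, hsq, sq]
  · rw [transpose_mul, transpose_mul, transpose_mul, transpose_transpose, diagonal_transpose,
      diagonal_transpose, Matrix.mul_assoc, ← Matrix.mul_assoc (diagonal _) (diagonal _),
      diagonal_mul_diagonal]
    congr 3
    ext i
    rw [div_mul_cancel₀ _ (hne i)]
  · rw [transpose_mul, diagonal_transpose, Matrix.mul_assoc, Matrix.mul_assoc,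
      ← Matrix.mul_assoc (diagonal _) (diagonal _), diagonal_mul_diagonal]
    congr 3
    ext i
    rw [mul_div_cancel₀ _ (hne i)]
  · rw [transpose_mul, diagonal_transpose, Matrix.mul_assoc, Matrix.mul_assoc,
      ← Matrix.mul_assoc (diagonal _) (diagonal _), diagonal_mul_diagonal]
    congr 3
    ext i
    rw [hsq]

open Matrix in
theorem trace_mul_diagonal_mul_transpose {ι p : Type*} [Fintype ι] [Fintype p] [DecidableEq ι]
    {U : Matrix p ι ℝ} (hU : Uᵀ * U = 1) (y : ι → ℝ) :
    (U * diagonal y * Uᵀ).trace = ∑ i, y i := by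
  rw [trace_mul_comm, ← Matrix.mul_assoc, hU, Matrix.one_mul, trace_diagonal]

-- Stated for the factors, so that it serves both versions, and with real values, so that `g(X)` can
-- be added as a constant.
open Matrix in
theorem isLeast_of_factors {ι : Type*} [Fintype ι] [DecidableEq ι] {p q : ℕ}
    {lam γ : ℝ} (hlam : 0 ≤ lam) (hγ : 0 < γ) {U : Matrix (Fin p) ι ℝ} {V : Matrix (Fin q) ι ℝ}
    (hU : Uᵀ * U = 1) (hV : Vᵀ * V = 1) {s : ι → ℝ} (hs : ∀ i, 0 < s i) :
    IsLeast {c : ℝ | ∃ (Y : Matrix (Fin p) (Fin p) ℝ) (θ : Matrix (Fin q) (Fin q) ℝ),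
        Y ∈ convexHull ℝ (orthProjMatrices p) ∧ θ.IsSymm ∧
        (fromBlocks θ (U * diagonal s * Vᵀ)ᵀ (U * diagonal s * Vᵀ) Y).PosSemidef ∧
        1 / (2 * γ) * θ.trace + lam * Y.trace = c}
      (∑ i, reverseHuber lam γ (s i)) := by
  constructor
  · choose y hy0 hy1 hy using fun i => exists_reverseHuber_eq hlam hγ (hs i)
    refine ⟨U * diagonal y * Uᵀ, V * diagonal (fun i => s i ^ 2 / y i) * Vᵀ,
      mul_diagonal_mul_transpose_mem_convexHull hU fun i => ⟨(hy0 i).le, hy1 i⟩,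
      by simp [Matrix.IsSymm, Matrix.mul_assoc], posSemidef_fromBlocks_of_factors U V s hy0, ?_⟩
    rw [trace_mul_diagonal_mul_transpose hU, trace_mul_diagonal_mul_transpose hV, Finset.mul_sum,
      Finset.mul_sum, ← Finset.sum_add_distrib]
    exact Finset.sum_congr rfl fun i _ => hy i
  · rintro c ⟨Y, θ, hY, -, hM, rfl⟩
    rw [convexHull_orthProjMatrices] at hY
    exact sum_reverseHuber_le hlam hγ hU hV s hY.1 hY.2 hM

theorem IsLeast.image_add_coe {S : Set ℝ} {c : ℝ} (h : IsLeast S c) (a : EReal) :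
    IsLeast ((fun r : ℝ => a + (r : EReal)) '' S) (a + (c : EReal)) := by
  refine Monotone.map_isLeast (fun x y hxy => ?_) h
  exact add_le_add le_rfl (EReal.coe_le_coe_iff.mpr hxy)

open Matrix in
theorem perspectiveRelaxation_isLeast {n m : ℕ} (g : Matrix (Fin n) (Fin m) ℝ → EReal)
    {lam γ : ℝ} (hlam : 0 ≤ lam) (hγ : 0 < γ) (X : Matrix (Fin n) (Fin m) ℝ) :
    IsLeast {c : EReal | ∃ d, (X, d) ∈ (perspectiveRelaxation g lam γ).feasible ∧
      (perspectiveRelaxation g lam γ).objective (X, d) = c}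
      ((reverseHuberProblem g lam γ).objective X) := by
  obtain ⟨r, U, V, s, hU, hV, hs, rfl, hf⟩ := exists_compact_svd X
  have h := (isLeast_of_factors hlam hγ hU hV hs).image_add_coe (g (U * diagonal s * Vᵀ))
  rw [← hf _ (reverseHuber_zero lam γ)] at h
  convert! h using 1
  ext c
  constructor
  · rintro ⟨⟨Y, θ⟩, ⟨hY, hθ, hM⟩, rfl⟩
    exact ⟨_, ⟨Y, θ, hY, hθ, hM, rfl⟩, rfl⟩
  · rintro ⟨_, ⟨Y, θ, hY, hθ, hM, rfl⟩, rfl⟩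
    exact ⟨(Y, θ), ⟨hY, hθ, hM⟩, rfl⟩

open Matrix in
theorem perspectiveRelaxationRow_isLeast {n m : ℕ} (g : Matrix (Fin n) (Fin m) ℝ → EReal)
    {lam γ : ℝ} (hlam : 0 ≤ lam) (hγ : 0 < γ) (X : Matrix (Fin n) (Fin m) ℝ) :
    IsLeast {c : EReal | ∃ d, (X, d) ∈ (perspectiveRelaxationRow g lam γ).feasible ∧
      (perspectiveRelaxationRow g lam γ).objective (X, d) = c}
      ((reverseHuberProblem g lam γ).objective X) := by
  obtain ⟨r, U, V, s, hU, hV, hs, hX, hf⟩ := exists_compact_svd X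
  have h := (isLeast_of_factors hlam hγ hV hU hs).image_add_coe (g X)
  -- The column result is applied to `Xᵀ`, which has the same `s`; the sum over `s` is still
  -- rewritten through the singular values of `X`.
  have hXT : V * diagonal s * Uᵀ = Xᵀ := by simp [hX, Matrix.mul_assoc]
  rw [← hf _ (reverseHuber_zero lam γ), hXT, transpose_transpose] at h
  convert! h using 1
  ext c
  constructor
  · rintro ⟨⟨Y, θ⟩, ⟨hY, hθ, hM⟩, rfl⟩
    exact ⟨_, ⟨Y, θ, hY, hθ, hM, rfl⟩, rfl⟩
  · rintro ⟨_, ⟨Y, θ, hY, hθ, hM, rfl⟩, rfl⟩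
    exact ⟨(Y, θ), ⟨hY, hθ, hM⟩, rfl⟩

/-! ### From attained partial minima to equivalence. -/

namespace MinProblem

theorem isEquivalent_of_isLeast {E D : Type*} {P : MinProblem (E × D)} {Q : MinProblem E}
    (hQ : Q.feasible = Set.univ)
    (h : ∀ x, IsLeast {c : EReal | ∃ d, (x, d) ∈ P.feasible ∧ P.objective (x, d) = c}
      (Q.objective x))
    (hex : (∃ x ∈ Q.feasible, Q.objective x ≠ ⊤) → ∃ x, Q.IsOptimal x) : P.IsEquivalent Q where
  value_eq := by
    have hmem : ∀ x, x ∈ Q.feasible := fun x => hQ ▸ Set.mem_univ x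
    apply le_antisymm
    · refine le_iInf₂ fun x _ => ?_
      obtain ⟨d, hd, hd'⟩ := (h x).1
      exact hd' ▸ iInf₂_le (x, d) hd
    · refine le_iInf₂ fun v hv => ?_
      exact (iInf₂_le v.1 (hmem v.1)).trans ((h v.1).2 ⟨v.2, hv, rfl⟩)
  isOptimal_iff x := by
    have hmem : ∀ x, x ∈ Q.feasible := fun x => hQ ▸ Set.mem_univ x
    constructor
    · rintro ⟨-, hfin, hmin⟩
      obtain ⟨d, hd, hd'⟩ := (h x).1
      refine ⟨d, hd, hd' ▸ hfin, fun w hw => ?_⟩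
      rw [hd']
      exact (hmin w.1 (hmem _)).trans ((h w.1).2 ⟨w.2, hw, rfl⟩)
    · rintro ⟨d, hd, hfin, hmin⟩
      have hle : Q.objective x ≤ P.objective (x, d) := (h x).2 ⟨d, hd, rfl⟩
      refine ⟨hmem x, fun htop => hfin (top_le_iff.mp (htop ▸ hle)), fun w _ => ?_⟩
      obtain ⟨d', hd', hw⟩ := (h w).1
      exact hw ▸ hle.trans (hmin _ hd')
  isLeast x _ := h x
  exists_isOptimal := hex

end MinProblem

/-! ### Existence of a minimizer. -/

theorem isCompact_matrix_Icc (n m : ℕ) (b : ℝ) :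
    IsCompact {M : Matrix (Fin n) (Fin m) ℝ | ∀ i j, M i j ∈ Set.Icc (-b) b} := by
  have h : IsCompact (Set.univ.pi fun _ : Fin n => Set.univ.pi fun _ : Fin m => Set.Icc (-b) b) :=
    isCompact_univ_pi fun _ => isCompact_univ_pi fun _ => isCompact_Icc
  convert! h using 1
  ext M
  exact ⟨fun hM i _ j _ => hM i j, fun hM i j => hM i trivial j trivial⟩

open Matrix in
theorem isClosed_setOf_posSemidef (ι : Type*) [Fintype ι] :
    IsClosed {M : Matrix ι ι ℝ | M.PosSemidef} := by
  simp only [posSemidef_iff_dotProduct_mulVec, Set.ofPred_and, Set.ofPred_forall]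
  refine (isClosed_eq (by fun_prop) continuous_id).inter (isClosed_iInter fun x => ?_)
  exact isClosed_le continuous_const
    (Continuous.dotProduct continuous_const (Continuous.matrix_mulVec continuous_id continuous_const))

-- By the `2 × 2` minors, bounding `tr θ` alone bounds the whole triple.
open Matrix in
theorem entry_bounds_of_fromBlocks {n m : ℕ} {X : Matrix (Fin n) (Fin m) ℝ}
    {Y : Matrix (Fin n) (Fin n) ℝ} {θ : Matrix (Fin m) (Fin m) ℝ} (hY : Y.PosSemidef)
    (hY' : (1 - Y).PosSemidef) (hM : (fromBlocks θ Xᵀ X Y).PosSemidef) :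
    (∀ i j, |Y i j| ≤ 1) ∧ (∀ i j, |θ i j| ≤ θ.trace) ∧ ∀ i j, X i j ^ 2 ≤ θ.trace := by
  have hθ : θ.PosSemidef := hM.submatrix Sum.inl
  have hY1 : ∀ i, Y i i ≤ 1 := fun i => by simpa using hY'.diag_nonneg (i := i)
  have ht : 0 ≤ θ.trace := hθ.trace_nonneg
  have hθt : ∀ i, θ i i ≤ θ.trace := fun i =>
    Finset.single_le_sum (f := fun i => θ i i) (fun j _ => hθ.diag_nonneg) (Finset.mem_univ i)
  refine ⟨fun i j => ?_, fun i j => ?_, fun i j => ?_⟩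
  · refine abs_le_of_sq_le_sq ?_ zero_le_one
    calc Y i j ^ 2 ≤ Y i i * Y j j := hY.sq_apply_le i j
      _ ≤ 1 * 1 := mul_le_mul (hY1 i) (hY1 j) hY.diag_nonneg zero_le_one
      _ = 1 ^ 2 := by norm_num
  · refine abs_le_of_sq_le_sq ?_ ht
    calc θ i j ^ 2 ≤ θ i i * θ j j := hθ.sq_apply_le i j
      _ ≤ θ.trace * θ.trace := mul_le_mul (hθt i) (hθt j) hθ.diag_nonneg ht
      _ = θ.trace ^ 2 := by ring
  · calc X i j ^ 2 ≤ Y i i * θ j j := by simpa using hM.sq_apply_le (Sum.inr i) (Sum.inl j)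
      _ ≤ 1 * θ.trace := mul_le_mul (hY1 i) (hθt j) hθ.diag_nonneg zero_le_one
      _ = θ.trace := one_mul _

theorem neg_sum_abs_mul_sqrt_le {n m : ℕ} (C X : Matrix (Fin n) (Fin m) ℝ) {t : ℝ}
    (h : ∀ i j, X i j ^ 2 ≤ t) :
    -((∑ i, ∑ j, |C i j|) * √t) ≤ ∑ i, ∑ j, C i j * X i j := by
  rw [Finset.sum_mul, ← Finset.sum_neg_distrib]
  refine Finset.sum_le_sum fun i _ => ?_
  rw [Finset.sum_mul, ← Finset.sum_neg_distrib]
  refine Finset.sum_le_sum fun j _ => ?_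
  have h1 : |C i j * X i j| ≤ |C i j| * √t := by
    rw [abs_mul]
    exact mul_le_mul_of_nonneg_left (Real.abs_le_sqrt (h i j)) (abs_nonneg _)
  exact (neg_le_neg h1).trans (neg_abs_le _)

open Matrix in
theorem exists_isMinOn_perspective {n m l : ℕ} (C : Matrix (Fin n) (Fin m) ℝ)
    (A : Matrix (Fin l) (Fin n) ℝ) (B : Matrix (Fin l) (Fin m) ℝ)
    (K : ProperCone ℝ (Matrix (Fin n) (Fin m) ℝ)) {lam γ : ℝ} (hlam : 0 ≤ lam) (hγ : 0 < γ)
    {F : Set (Matrix (Fin n) (Fin m) ℝ × Matrix (Fin n) (Fin n) ℝ × Matrix (Fin m) (Fin m) ℝ)}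
    (hF : F = {v | A * v.1 = B ∧ v.1 ∈ K ∧ v.2.1.PosSemidef ∧ (1 - v.2.1).PosSemidef ∧
      (fromBlocks v.2.2 v.1ᵀ v.1 v.2.1).PosSemidef}) (hne : F.Nonempty) :
    ∃ v ∈ F, IsMinOn (fun v => ∑ i, ∑ j, C i j * v.1 i j +
      (1 / (2 * γ) * v.2.2.trace + lam * v.2.1.trace)) F v := by
  set f : Matrix (Fin n) (Fin m) ℝ × Matrix (Fin n) (Fin n) ℝ × Matrix (Fin m) (Fin m) ℝ → ℝ :=
    fun v => ∑ i, ∑ j, C i j * v.1 i j + (1 / (2 * γ) * v.2.2.trace + lam * v.2.1.trace) with hf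
  have hfc : Continuous f := by
    have h1 : ∀ i j, Continuous fun v : Matrix (Fin n) (Fin m) ℝ × Matrix (Fin n) (Fin n) ℝ ×
        Matrix (Fin m) (Fin m) ℝ => v.1 i j := fun i j => continuous_fst.matrix_elem i j
    have h2 := (continuous_fst.comp (continuous_snd (X := Matrix (Fin n) (Fin m) ℝ)
      (Y := Matrix (Fin n) (Fin n) ℝ × Matrix (Fin m) (Fin m) ℝ))).matrix_trace
    have h3 := (continuous_snd.comp (continuous_snd (X := Matrix (Fin n) (Fin m) ℝ)
      (Y := Matrix (Fin n) (Fin n) ℝ × Matrix (Fin m) (Fin m) ℝ))).matrix_trace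
    exact (continuous_finsetSum _ fun i _ => continuous_finsetSum _ fun j _ =>
      continuous_const.mul (h1 i j)).add ((continuous_const.mul h3).add (continuous_const.mul h2))
  have hFc : IsClosed F := by
    rw [hF]
    simp only [Set.ofPred_and]
    refine IsClosed.inter (isClosed_eq (by fun_prop) continuous_const) (IsClosed.inter
      (K.isClosed.preimage continuous_fst) (IsClosed.inter
      ((isClosed_setOf_posSemidef _).preimage (by fun_prop)) (IsClosed.inter
      ((isClosed_setOf_posSemidef _).preimage (f := fun v : Matrix (Fin n) (Fin m) ℝ ×
        Matrix (Fin n) (Fin n) ℝ × Matrix (Fin m) (Fin m) ℝ => 1 - v.2.1) (by fun_prop))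
      ((isClosed_setOf_posSemidef _).preimage (f := fun v : Matrix (Fin n) (Fin m) ℝ ×
        Matrix (Fin n) (Fin n) ℝ × Matrix (Fin m) (Fin m) ℝ => fromBlocks v.2.2 v.1ᵀ v.1 v.2.1)
        (Continuous.matrix_fromBlocks (by fun_prop) (by fun_prop) (by fun_prop)
          (by fun_prop))))))
  obtain ⟨v₀, hv₀⟩ := hne
  set c := ∑ i, ∑ j, |C i j|
  -- With `t = tr θ`, `c√t ≤ t/(4γ) + γc²` absorbs half of `t/(2γ)`; the other half gives `t ≤ R` on
  -- the sublevel set.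
  set R := 4 * γ * (f v₀ + γ * c ^ 2) with hR
  have hcomp : IsCompact (F ∩ {v | f v ≤ f v₀}) := by
    -- The radius `R + 1` covers all three blocks: `|Y i j| ≤ 1`, `|θ i j| ≤ R`, and `X i j ^ 2 ≤ R
    -- ≤ (R + 1)²`.
    refine ((isCompact_matrix_Icc n m (R + 1)).prod ((isCompact_matrix_Icc n n (R + 1)).prod
      (isCompact_matrix_Icc m m (R + 1)))).of_isClosed_subset
      (hFc.inter (isClosed_le hfc continuous_const)) ?_
    rintro ⟨X, Y, θ⟩ ⟨hv, hle⟩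
    rw [hF] at hv
    obtain ⟨-, -, hY, hY', hM⟩ := hv
    obtain ⟨bY, bθ, bX⟩ := entry_bounds_of_fromBlocks hY hY' hM
    dsimp only at bY bθ bX hY hM
    have ht : 0 ≤ θ.trace := PosSemidef.trace_nonneg (hM.submatrix Sum.inl)
    have hYt : 0 ≤ lam * Y.trace := mul_nonneg hlam hY.trace_nonneg
    have hCX := neg_sum_abs_mul_sqrt_le C X bX
    have htR : θ.trace ≤ R := by
      simp only [hf, Set.mem_ofPred_eq] at hle
      have h1 : c * √θ.trace ≤ 1 / (4 * γ) * θ.trace + γ * c ^ 2 := by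
        have h2 : 1 / (4 * γ) * θ.trace + γ * c ^ 2 - c * √θ.trace =
            1 / (4 * γ) * (√θ.trace - 2 * γ * c) ^ 2 := by
          nth_rewrite 1 [← Real.sq_sqrt ht]
          field_simp
          ring
        have h3 : 0 ≤ 1 / (4 * γ) * (√θ.trace - 2 * γ * c) ^ 2 := by positivity
        linarith
      have h4 : 1 / (4 * γ) * θ.trace ≤ f v₀ + γ * c ^ 2 := by
        have h5 : 1 / (2 * γ) * θ.trace = 1 / (4 * γ) * θ.trace + 1 / (4 * γ) * θ.trace := by
          field_simp
          ring
        linarith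
      calc θ.trace = 4 * γ * (1 / (4 * γ) * θ.trace) := by field_simp
        _ ≤ R := mul_le_mul_of_nonneg_left h4 (by positivity)
    refine ⟨fun i j => abs_le.mp ?_, fun i j => abs_le.mp ?_, fun i j => abs_le.mp ?_⟩
    · refine abs_le_of_sq_le_sq ?_ (by linarith)
      exact (bX i j).trans (by nlinarith)
    · exact (bY i j).trans (by linarith)
    · exact (bθ i j).trans (by linarith)
  obtain ⟨v, hv, hmin⟩ := hcomp.exists_isMinOn ⟨v₀, hv₀, le_refl (f v₀)⟩ hfc.continuousOn
  refine ⟨v, hv.1, fun w hw => ?_⟩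
  by_cases h : f w ≤ f v₀
  · exact hmin ⟨hw, h⟩
  · exact (show f v ≤ f v₀ from hv.2).trans (not_le.mp h).le

-- The `X`-part of a joint minimizer is optimal: its penalized cost is at most the joint minimum,
-- while the cost of any other `W` with finite `g(W)` is itself attained by a joint feasible point.
open Matrix in
theorem reverseHuberProblem_exists_isOptimal {n m l : ℕ} (C : Matrix (Fin n) (Fin m) ℝ)
    (A : Matrix (Fin l) (Fin n) ℝ) (B : Matrix (Fin l) (Fin m) ℝ)
    (K : ProperCone ℝ (Matrix (Fin n) (Fin m) ℝ)) {lam γ : ℝ} (hlam : 0 ≤ lam) (hγ : 0 < γ)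
    (hfin : ∃ X, secondStageCost C A B K X ≠ ⊤) :
    ∃ X, (reverseHuberProblem (secondStageCost C A B K) lam γ).IsOptimal X := by
  have hleast := perspectiveRelaxation_isLeast (secondStageCost C A B K) hlam hγ
  have hdom : ∀ X, secondStageCost C A B K X ≠ ⊤ → A * X = B ∧ X ∈ K := by
    intro X hX
    by_contra h
    exact hX (if_neg h)
  have hobj : ∀ X d, A * X = B ∧ X ∈ K →
      (perspectiveRelaxation (secondStageCost C A B K) lam γ).objective (X, d) =
      ((∑ i, ∑ j, C i j * X i j + (1 / (2 * γ) * d.2.trace + lam * d.1.trace) : ℝ) : EReal) := by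
    intro X d hX
    rw [EReal.coe_add, ← (if_pos hX : secondStageCost C A B K X = _)]
    rfl
  obtain ⟨X₀, hX₀⟩ := hfin
  obtain ⟨⟨Y₀, θ₀⟩, ⟨hY₀, -, hM₀⟩, -⟩ := (hleast X₀).1
  rw [convexHull_orthProjMatrices] at hY₀
  obtain ⟨⟨X, Y, θ⟩, ⟨hAX, hXK, hY, hY', hM⟩, hmin⟩ := exists_isMinOn_perspective C A B K hlam hγ
    rfl ⟨(X₀, Y₀, θ₀), (hdom X₀ hX₀).1, (hdom X₀ hX₀).2, hY₀.1, hY₀.2, hM₀⟩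
  have hle := (hleast X).2 ⟨(Y, θ), ⟨by rw [convexHull_orthProjMatrices]; exact ⟨hY, hY'⟩,
    (hM.submatrix Sum.inl).1, hM⟩, hobj X (Y, θ) ⟨hAX, hXK⟩⟩
  refine ⟨X, trivial, (hle.trans_lt (EReal.coe_lt_top _)).ne, fun W _ => ?_⟩
  by_cases hW : secondStageCost C A B K W = ⊤
  · have h : (reverseHuberProblem (secondStageCost C A B K) lam γ).objective W = ⊤ := by
      change secondStageCost C A B K W + _ = ⊤
      rw [hW, EReal.top_add_coe]
    rw [h]
    exact le_top
  · obtain ⟨⟨Y', θ'⟩, ⟨hYW, -, hMW⟩, hW'⟩ := (hleast W).1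
    rw [convexHull_orthProjMatrices] at hYW
    rw [← hW', hobj W _ (hdom W hW)]
    refine hle.trans (EReal.coe_le_coe_iff.mpr ?_)
    exact hmin (a := (W, Y', θ')) ⟨(hdom W hW).1, (hdom W hW).2, hYW.1, hYW.2, hMW⟩

theorem lemma7 {n m l : ℕ} (C : Matrix (Fin n) (Fin m) ℝ) (A : Matrix (Fin l) (Fin n) ℝ)
    (B : Matrix (Fin l) (Fin m) ℝ) (K : ProperCone ℝ (Matrix (Fin n) (Fin m) ℝ))
    (lam γ : ℝ) (hlam : 0 ≤ lam) (hγ : 0 < γ) :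
    (perspectiveRelaxation (secondStageCost C A B K) lam γ).IsEquivalent
        (reverseHuberProblem (secondStageCost C A B K) lam γ) ∧
      (perspectiveRelaxationRow (secondStageCost C A B K) lam γ).IsEquivalent
        (reverseHuberProblem (secondStageCost C A B K) lam γ) := by
  have hex : (∃ X ∈ (reverseHuberProblem (secondStageCost C A B K) lam γ).feasible,
      (reverseHuberProblem (secondStageCost C A B K) lam γ).objective X ≠ ⊤) →
      ∃ X, (reverseHuberProblem (secondStageCost C A B K) lam γ).IsOptimal X := by
    rintro ⟨X, -, hX⟩
    refine reverseHuberProblem_exists_isOptimal C A B K hlam hγ ⟨X, fun htop => hX ?_⟩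
    change secondStageCost C A B K X + _ = ⊤
    rw [htop, EReal.top_add_coe]
  exact ⟨MinProblem.isEquivalent_of_isLeast rfl (perspectiveRelaxation_isLeast _ hlam hγ) hex,
    MinProblem.isEquivalent_of_isLeast rfl (perspectiveRelaxationRow_isLeast _ hlam hγ) hex⟩
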